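/- Let $S^1=\mathbb{R}/\mathbb{Z}$ with its usual metric $d$, and let $f:S^1\to S^1$ be a homeomorphism. For a Borel probability measure $\mu$ on $S^1$, $f$ is called $\mu$-expansive if there is $\delta>0$ such that $\mu(\Gamma_\delta(x))=0$ for all $x\in S^1$, where $$\Gamma_\delta(x)=\{y\in S^1 : d(f^i(x),f^i(y))\le\delta \text{ for all } i\in\mathbb{Z}\}.$$ Call $f$ Denjoy if it is orientation preserving, has no periodic points, and is not topologically conjugate to a rotation $x\mapsto x+a$ of $S^1$. Then $f$ is $\mu$-expansive for some Borel probability measure $\mu$ on $S^1$ if and only if $f$ is Denjoy. -/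

import Mathlib

open MeasureTheory

/-- The set `Γ_δ(x)` of the points `y` with `d(f^i(x), f^i(y)) ≤ δ` for all `i ∈ ℤ`;
`f ^ i` is the `i`-th iterate in the group of self-homeomorphisms of `X`. -/
def dynamicalBall {X : Type*} [MetricSpace X] (f : X ≃ₜ X) (δ : ℝ) (x : X) : Set X :=
  {y | ∀ i : ℤ, dist ((f ^ i) x) ((f ^ i) y) ≤ δ}

/-- `f` is `μ`-expansive: for some `δ > 0`, all the sets `Γ_δ(x)` are `μ`-null. -/
def IsMeasureExpansive {X : Type*} [MetricSpace X] [MeasurableSpace X] [BorelSpace X]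
    (f : X ≃ₜ X) (μ : Measure X) : Prop :=
  ∃ δ : ℝ, 0 < δ ∧ ∀ x : X, μ (dynamicalBall f δ x) = 0

/-- A homeomorphism of the circle `ℝ/ℤ` is orientation preserving: it has a continuous monotone
lift `F : ℝ → ℝ` with `F (t + 1) = F t + 1`. -/
def IsOrientationPreserving (f : UnitAddCircle ≃ₜ UnitAddCircle) : Prop :=
  ∃ F : CircleDeg1Lift, Continuous F ∧ ∀ t : ℝ, ((F t : ℝ) : UnitAddCircle) = f (t : UnitAddCircle)

/-- `f` is topologically conjugate to a rotation `R_a : x ↦ x + a` of `ℝ/ℤ`. -/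
def IsConjugateToRotation (f : UnitAddCircle ≃ₜ UnitAddCircle) : Prop :=
  ∃ (a : UnitAddCircle) (h : UnitAddCircle ≃ₜ UnitAddCircle),
    Function.Semiconj h f (fun x => x + a)

/-- Denjoy homeomorphisms of the circle. -/
structure IsDenjoy (f : UnitAddCircle ≃ₜ UnitAddCircle) : Prop where
  orientationPreserving : IsOrientationPreserving f
  not_conjugate : ¬ IsConjugateToRotation f
  no_periodic : Function.periodicPts f = ∅

open Set Filter Topology

/-! If `f` is conjugate to a rotation, its iterates are equicontinuous, so dynamical balls are
neighbourhoods and an expansive measure is locally null, hence zero. A periodic point has the same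
effect: some power preserves orientation and fixes a point, its non-fixed points have monotone
bounded lifted orbits, and its fixed points do not move. Orientation-reversing maps have fixed
points, so an expansive probability measure leaves only Denjoy maps.

Conversely, a Denjoy map has irrational translation number `τ`, and a monotone `h` semiconjugates
its lift to translation by `τ`. As `f` is not conjugate to a rotation, `h` is constant on some `[a,
b]` with `a < b`. Points with different `h`-values are at some time separated by an integer
translate of `[a, b]`, so a small dynamical ball lies in one fibre of `h`, null for the measure
`dh`. -/

theorem UnitAddCircle.coe_eq_coe_iff {s t : ℝ} :
    (s : UnitAddCircle) = t ↔ ∃ n : ℤ, s = t + n := by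
  rw [eq_comm, QuotientAddGroup.eq, AddSubgroup.mem_zmultiples_iff]
  refine exists_congr fun n => ?_
  simp only [zsmul_eq_mul, mul_one]
  constructor <;> intro h <;> linarith

/-! ### Lifts to the line -/

/-- `F` is a lift of the circle homeomorphism `f` to the real line. -/
def IsLift (F : ℝ ≃ₜ ℝ) (f : UnitAddCircle ≃ₜ UnitAddCircle) : Prop :=
  ∀ t : ℝ, ((F t : ℝ) : UnitAddCircle) = f t

theorem UnitAddCircle.dist_coe_le (s t : ℝ) :
    dist (s : UnitAddCircle) t ≤ |s - t| := by
  rw [dist_eq_norm, ← AddCircle.coe_sub, UnitAddCircle.norm_eq]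
  simpa using round_le (s - t) 0

theorem UnitAddCircle.dist_coe_eq {s t : ℝ} (h : |s - t| ≤ 1 / 2) :
    dist (s : UnitAddCircle) t = |s - t| := by
  rw [dist_eq_norm, ← AddCircle.coe_sub, AddCircle.norm_coe_eq_abs_iff 1 one_ne_zero]
  simpa using h

theorem UnitAddCircle.exists_coe_eq_abs_sub_eq_dist (s : ℝ) (y : UnitAddCircle) :
    ∃ t : ℝ, (t : UnitAddCircle) = y ∧ |s - t| = dist (s : UnitAddCircle) y := by
  obtain ⟨t, rfl⟩ := QuotientAddGroup.mk_surjective y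
  refine ⟨t + round (s - t), ?_, ?_⟩
  · exact UnitAddCircle.coe_eq_coe_iff.2 ⟨_, rfl⟩
  · rw [dist_eq_norm, ← AddCircle.coe_sub, UnitAddCircle.norm_eq, sub_add_eq_sub_sub]

/-- A continuous integer-valued function on the line is constant. -/
theorem exists_int_eq_of_continuous {u : ℝ → ℝ} (hu : Continuous u)
    (h : ∀ t, ∃ n : ℤ, u t = n) : ∃ n : ℤ, ∀ t, u t = n := by
  choose k hk using h
  have hk' : Continuous k := by
    rw [Int.isClosedEmbedding_coe_real.isEmbedding.continuous_iff]
    exact hu.congr hk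
  exact ⟨k 0, fun t => by rw [hk, PreconnectedSpace.constant inferInstance hk' (x := t) (y := 0)]⟩

theorem exists_continuous_lift {f : UnitAddCircle → UnitAddCircle} (hf : Continuous f) :
    ∃ F : ℝ → ℝ, Continuous F ∧ ∀ t : ℝ, ((F t : ℝ) : UnitAddCircle) = f t := by
  obtain ⟨e, he⟩ := QuotientAddGroup.mk_surjective (f ((0 : ℝ) : UnitAddCircle))
  obtain ⟨F, ⟨-, hF⟩, -⟩ :=
    (AddCircle.isCoveringMap_coe (1 : ℝ)).existsUnique_continuousMap_lifts
      ⟨fun t : ℝ => f t, hf.comp (AddCircle.continuous_mk' 1)⟩ 0 e he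
  exact ⟨F, F.continuous, fun t => congrFun hF t⟩

/-- Lifts of `f` and `f⁻¹` compose to the identity up to a constant integer, which is absorbed into
the second lift. -/
theorem exists_isLift (f : UnitAddCircle ≃ₜ UnitAddCircle) : ∃ F : ℝ ≃ₜ ℝ, IsLift F f := by
  obtain ⟨F, hFc, hF⟩ := exists_continuous_lift f.continuous
  obtain ⟨G, hGc, hG⟩ := exists_continuous_lift f.symm.continuous
  obtain ⟨c, hc⟩ := exists_int_eq_of_continuous (u := fun t => G (F t) - t) (by fun_prop) fun t => by
    obtain ⟨n, hn⟩ := UnitAddCircle.coe_eq_coe_iff.1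
      (show ((G (F t) : ℝ) : UnitAddCircle) = t by rw [hG, hF, f.symm_apply_apply])
    exact ⟨n, by rw [hn]; ring⟩
  obtain ⟨d, hd⟩ := exists_int_eq_of_continuous (u := fun t => F (G t - c) - t) (by fun_prop)
    fun t => by
      have h1 : ((G t - c : ℝ) : UnitAddCircle) = (G t : ℝ) :=
        UnitAddCircle.coe_eq_coe_iff.2 ⟨-c, by push_cast; ring⟩
      obtain ⟨n, hn⟩ := UnitAddCircle.coe_eq_coe_iff.1
        (show ((F (G t - c) : ℝ) : UnitAddCircle) = t by rw [hF, h1, hG, f.apply_symm_apply])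
      exact ⟨n, by rw [hn]; ring⟩
  have hGF : ∀ t, G (F t) - c = t := fun t => by linarith [hc t]
  have hd0 : (d : ℝ) = 0 := by
    have := hd (F 0)
    rw [hGF, sub_self] at this
    exact this.symm
  exact ⟨⟨⟨F, fun s => G s - c, hGF, fun s => by linarith [hd s]⟩, hFc, by fun_prop⟩, hF⟩

namespace IsLift

variable {F G : ℝ ≃ₜ ℝ} {f g : UnitAddCircle ≃ₜ UnitAddCircle}

theorem mul (hF : IsLift F f) (hG : IsLift G g) : IsLift (F * G) (f * g) := fun t => by
  change ((F (G t) : ℝ) : UnitAddCircle) = f (g t)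
  rw [hF, hG]

theorem inv (hF : IsLift F f) : IsLift F⁻¹ f⁻¹ := fun t => by
  change ((F.symm t : ℝ) : UnitAddCircle) = f.symm t
  refine f.injective ?_
  rw [← hF, f.apply_symm_apply, F.apply_symm_apply]

theorem zpow (hF : IsLift F f) (i : ℤ) : IsLift (F ^ i) (f ^ i) := by
  induction i with
  | zero => exact fun t => rfl
  | succ n ih => rw [zpow_add_one, zpow_add_one]; exact ih.mul hF
  | pred n ih => rw [zpow_sub_one, zpow_sub_one]; exact ih.mul hF.inv

theorem map_add_one_of_strictMono (hF : IsLift F f) (hm : StrictMono F) (t : ℝ) :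
    F (t + 1) = F t + 1 := by
  obtain ⟨k, hk⟩ := UnitAddCircle.coe_eq_coe_iff.1
    (show ((F (t + 1) : ℝ) : UnitAddCircle) = F t by rw [hF, hF]; simp)
  have hk0 : 0 < k := by
    have := hm (lt_add_one t)
    rw [hk] at this
    exact_mod_cast (lt_add_iff_pos_right _).1 this
  rcases (Int.add_one_le_iff.2 hk0).eq_or_lt with h | h
  · rw [hk, ← h]; simp
  · exfalso
    have h1 : (1 : ℝ) < k := by exact_mod_cast h
    -- Degree above one would give `u` strictly between `t` and `t + 1` with the same image on the
    -- circle as `t`.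
    obtain ⟨u, hu⟩ := F.surjective (F t + 1)
    have htu : t < u := hm.lt_iff_lt.1 (by linarith)
    have hut : u < t + 1 := hm.lt_iff_lt.1 (by linarith)
    obtain ⟨n, hn⟩ := UnitAddCircle.coe_eq_coe_iff.1 (show (u : UnitAddCircle) = t by
      apply f.injective
      rw [← hF, ← hF, hu]
      simp)
    have h2 : (0 : ℝ) < n := by linarith
    have h3 : (n : ℝ) < 1 := by linarith
    have h2' : 0 < n := by exact_mod_cast h2
    have h3' : n < 1 := by exact_mod_cast h3
    omega

theorem map_add_one_of_strictAnti (hF : IsLift F f) (hm : StrictAnti F) (t : ℝ) :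
    F (t + 1) = F t - 1 := by
  have h : IsLift (F.trans (Homeomorph.neg ℝ)) (f.trans (Homeomorph.neg UnitAddCircle)) :=
    fun t => by
      change ((-F t : ℝ) : UnitAddCircle) = -f t
      rw [← hF]; rfl
  have := h.map_add_one_of_strictMono (fun a b hab => neg_lt_neg (hm hab)) t
  change -F (t + 1) = -F t + 1 at this
  linarith

end IsLift

/-! ### Fixed and periodic points exclude expansive measures -/

theorem Homeomorph.coe_pow_eq_iterate {X : Type*} [TopologicalSpace X] (f : X ≃ₜ X) (n : ℕ) :
    ⇑(f ^ n) = f^[n] := by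
  induction n with
  | zero => rfl
  | succ n ih => rw [pow_succ, Function.iterate_succ, ← ih]; rfl

theorem Homeomorph.zpow_apply_eq_self {X : Type*} [TopologicalSpace X] {f : X ≃ₜ X} {x : X}
    (h : f x = x) (i : ℤ) : (f ^ i) x = x := by
  have hinv : f⁻¹ x = x := by
    conv_lhs => rw [← h]
    exact f.symm_apply_apply x
  induction i with
  | zero => rfl
  | succ n ih =>
    rw [zpow_add_one]
    change (f ^ (n : ℤ)) (f x) = x
    rw [h, ih]
  | pred n ih =>
    rw [zpow_sub_one]
    change (f ^ (-n : ℤ)) (f⁻¹ x) = x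
    rw [hinv, ih]

theorem StrictMono.homeomorph_inv {G : ℝ ≃ₜ ℝ} (hG : StrictMono G) : StrictMono ⇑G⁻¹ :=
  fun a b hab => hG.lt_iff_lt.1 <| by
    change G (G.symm a) < G (G.symm b)
    simpa using hab

theorem StrictMono.homeomorph_zpow {G : ℝ ≃ₜ ℝ} (hG : StrictMono G) (i : ℤ) :
    StrictMono ⇑(G ^ i) := by
  induction i with
  | zero => exact strictMono_id
  | succ n ih => rw [zpow_add_one]; exact ih.comp hG
  | pred n ih => rw [zpow_sub_one]; exact ih.comp hG.homeomorph_inv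

/-- The orbit `u` is monotone and bounded, so `u (i + 1) - u (i - 1) < δ` for all but finitely many
`i`. These gaps control every `y` between `G⁻¹ x` and `G x`; continuity handles the remaining `i`.
-/
theorem eventually_forall_abs_zpow_sub_le_of_lt {G : ℝ ≃ₜ ℝ} (hG : StrictMono G) {x a b δ : ℝ}
    (hbd : ∀ i : ℤ, (G ^ i) x ∈ Icc a b) (hx : x < G x) (hδ : 0 < δ) :
    ∀ᶠ y in 𝓝 x, ∀ i : ℤ, |(G ^ i) x - (G ^ i) y| ≤ δ := by
  set u : ℤ → ℝ := fun i => (G ^ i) x with hu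
  have hsucc (i : ℤ) : u (i + 1) = (G ^ i) (G x) := by simp only [hu, zpow_add_one]; rfl
  have hpred (i : ℤ) : u (i - 1) = (G ^ i) (G⁻¹ x) := by simp only [hu, zpow_sub_one]; rfl
  have hmono : Monotone u := monotone_int_of_le_succ fun i => by
    rw [hsucc]; exact (hG.homeomorph_zpow i).monotone hx.le
  have htop := tendsto_atTop_ciSup hmono ⟨b, by rintro _ ⟨i, rfl⟩; exact (hbd i).2⟩
  have hbot := tendsto_atBot_ciInf hmono ⟨a, by rintro _ ⟨i, rfl⟩; exact (hbd i).1⟩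
  have h1 : ∀ᶠ i in atTop, u (i + 1) - u (i - 1) < δ := by
    have := (htop.comp (tendsto_atTop_add_const_right _ (1 : ℤ) tendsto_id)).sub
      (htop.comp (tendsto_atTop_add_const_right _ (-1 : ℤ) tendsto_id))
    rw [sub_self] at this
    exact this.eventually_lt_const hδ
  have h2 : ∀ᶠ i in atBot, u (i + 1) - u (i - 1) < δ := by
    have := (hbot.comp (tendsto_atBot_add_const_right _ (1 : ℤ) tendsto_id)).sub
      (hbot.comp (tendsto_atBot_add_const_right _ (-1 : ℤ) tendsto_id))
    rw [sub_self] at this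
    exact this.eventually_lt_const hδ
  have hfin : {i : ℤ | ¬ u (i + 1) - u (i - 1) < δ}.Finite := by
    have : ∀ᶠ i in cofinite, u (i + 1) - u (i - 1) < δ := by
      rw [Int.cofinite_eq]; exact eventually_sup.2 ⟨h2, h1⟩
    exact this
  have h3 : ∀ᶠ y in 𝓝 x, ∀ i ∈ {i : ℤ | ¬ u (i + 1) - u (i - 1) < δ},
      |(G ^ i) x - (G ^ i) y| ≤ δ := by
    rw [eventually_all_finite hfin]
    intro i _
    have : Tendsto (fun y => |(G ^ i) x - (G ^ i) y|) (𝓝 x) (𝓝 |(G ^ i) x - (G ^ i) x|) :=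
      Continuous.tendsto (by fun_prop) x
    rw [sub_self, abs_zero] at this
    exact this.eventually_le_const hδ
  have hx' : G⁻¹ x < x := hG.lt_iff_lt.1 <| by
    change G (G.symm x) < G x
    rwa [G.apply_symm_apply]
  filter_upwards [h3, Ioo_mem_nhds hx' hx] with y hy hyx i
  by_cases hi : u (i + 1) - u (i - 1) < δ
  · have hGi := hG.homeomorph_zpow i
    have e1 := hGi hyx.1
    have e2 := hGi hyx.2
    have e3 := hGi hx
    have e4 := hGi hx'
    rw [hsucc, hpred] at hi
    rw [abs_le]
    constructor <;> linarith
  · exact hy i hi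

theorem eventually_forall_abs_zpow_sub_le {G : ℝ ≃ₜ ℝ} (hG : StrictMono G) {x a b δ : ℝ}
    (hbd : ∀ i : ℤ, (G ^ i) x ∈ Icc a b) (hx : G x ≠ x) (hδ : 0 < δ) :
    ∀ᶠ y in 𝓝 x, ∀ i : ℤ, |(G ^ i) x - (G ^ i) y| ≤ δ := by
  rcases hx.lt_or_gt with h | h
  · have h' : x < G⁻¹ x := hG.lt_iff_lt.1 <| by
      change G x < G (G.symm x)
      rwa [G.apply_symm_apply]
    filter_upwards [eventually_forall_abs_zpow_sub_le_of_lt hG.homeomorph_inv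
      (fun i => by rw [inv_zpow']; exact hbd (-i)) h' hδ] with y hy i
    simpa using hy (-i)
  · exact eventually_forall_abs_zpow_sub_le_of_lt hG hbd h hδ

theorem UnitAddCircle.coe_image_mem_nhds {x : ℝ} {s : Set ℝ} (hs : s ∈ 𝓝 x) :
    ((↑) : ℝ → UnitAddCircle) '' s ∈ 𝓝 (x : UnitAddCircle) :=
  QuotientAddGroup.isOpenMap_coe.image_mem_nhds hs

/-- If an orientation preserving circle homeomorphism has a fixed point, then the dynamical balls
at the points that are not fixed are neighbourhoods. -/
theorem IsLift.dynamicalBall_mem_nhds {G : ℝ ≃ₜ ℝ} {g : UnitAddCircle ≃ₜ UnitAddCircle}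
    (hG : IsLift G g) (hm : StrictMono G) {p x : UnitAddCircle} (hp : g p = p) (hx : g x ≠ x)
    {δ : ℝ} (hδ : 0 < δ) : dynamicalBall g δ x ∈ 𝓝 x := by
  obtain ⟨x, rfl⟩ := QuotientAddGroup.mk_surjective x
  obtain ⟨q, rfl⟩ := QuotientAddGroup.mk_surjective p
  obtain ⟨p, hpq, hpx, hxp⟩ : ∃ p : ℝ, (p : UnitAddCircle) = q ∧ p ≤ x ∧ x < p + 1 :=
    ⟨q + ⌊x - q⌋, UnitAddCircle.coe_eq_coe_iff.2 ⟨_, rfl⟩, by linarith [Int.floor_le (x - q)],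
      by linarith [Int.lt_floor_add_one (x - q)]⟩
  have hp' : g (p : UnitAddCircle) = p := by rw [hpq]; exact hp
  obtain ⟨m, hm'⟩ := UnitAddCircle.coe_eq_coe_iff.1 ((hG p).trans hp')
  -- This lift fixes `p` and `p + 1`, which confines the orbit of `x`.
  obtain ⟨H, hH⟩ : ∃ H : ℝ ≃ₜ ℝ, ∀ t, H t = G t - m :=
    ⟨G.trans (Homeomorph.subRight (m : ℝ)), fun t => rfl⟩
  have hHm : StrictMono H := fun a b hab => by rw [hH, hH]; linarith [hm hab]
  have hHl : IsLift H g := fun t => by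
    rw [hH, ← hG]
    exact UnitAddCircle.coe_eq_coe_iff.2 ⟨-m, by push_cast; ring⟩
  have hHp : H p = p := by rw [hH, hm']; ring
  have hHp1 : H (p + 1) = p + 1 := by rw [hHl.map_add_one_of_strictMono hHm, hHp]
  have hHx : H x ≠ x := fun h => hx <| by
    rw [← hHl, h]
  have key := eventually_forall_abs_zpow_sub_le (a := p) (b := p + 1) hHm (fun i => ⟨by
      conv_lhs => rw [← Homeomorph.zpow_apply_eq_self hHp i]
      exact (hHm.homeomorph_zpow i).monotone hpx, by
      conv_rhs => rw [← Homeomorph.zpow_apply_eq_self hHp1 i]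
      exact (hHm.homeomorph_zpow i).monotone hxp.le⟩) hHx hδ
  filter_upwards [UnitAddCircle.coe_image_mem_nhds key]
  rintro _ ⟨y, hy, rfl⟩ i
  change dist ((g ^ i) (x : UnitAddCircle)) _ ≤ δ
  rw [← hHl.zpow i, ← hHl.zpow i]
  exact (UnitAddCircle.dist_coe_le _ _).trans (hy i)

theorem IsMeasureExpansive.measure_eq_zero_of_isLift {G : ℝ ≃ₜ ℝ}
    {g : UnitAddCircle ≃ₜ UnitAddCircle} {μ : Measure UnitAddCircle} (he : IsMeasureExpansive g μ)
    (hG : IsLift G g) (hm : StrictMono G) {p : UnitAddCircle} (hp : g p = p) :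
    μ univ = 0 := by
  obtain ⟨δ, hδ, h⟩ := he
  have h1 : μ {x | g x ≠ x} = 0 := measure_null_of_locally_null _ fun x hx =>
    ⟨_, mem_nhdsWithin_of_mem_nhds (hG.dynamicalBall_mem_nhds hm hp hx hδ), h x⟩
  have h2 : μ {x | g x = x} = 0 := measure_null_of_locally_null _ fun x hx =>
    ⟨Metric.closedBall x δ ∩ {x | g x = x},
      inter_mem (mem_nhdsWithin_of_mem_nhds (Metric.closedBall_mem_nhds x hδ)) self_mem_nhdsWithin,
      measure_mono_null (show _ ⊆ dynamicalBall g δ x from fun y hy i => by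
        rw [Homeomorph.zpow_apply_eq_self hx, Homeomorph.zpow_apply_eq_self hy.2, dist_comm]
        exact hy.1) (h x)⟩
  rw [show (univ : Set UnitAddCircle) = {x | g x ≠ x} ∪ {x | g x = x} by
    ext x; simp [em']]
  exact measure_union_null h1 h2

theorem IsMeasureExpansive.pow {X : Type*} [MetricSpace X] [CompactSpace X] [MeasurableSpace X]
    [BorelSpace X] {f : X ≃ₜ X} {μ : Measure X} (he : IsMeasureExpansive f μ) {n : ℕ}
    (hn : 0 < n) : IsMeasureExpansive (f ^ n) μ := by
  obtain ⟨δ, hδ, h⟩ := he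
  have key : ∀ᶠ ε in 𝓝[>] (0 : ℝ), ∀ j ∈ Finset.range n, ∀ x y : X, dist x y ≤ ε →
      dist ((f ^ j) x) ((f ^ j) y) ≤ δ := by
    rw [Filter.eventually_all_finset]
    intro j _
    obtain ⟨ε₀, hε₀, H⟩ := Metric.uniformContinuous_iff.1
      (CompactSpace.uniformContinuous_of_continuous (f ^ j).continuous) δ hδ
    filter_upwards [mem_nhdsWithin_of_mem_nhds (Iio_mem_nhds hε₀)] with ε hε x y hxy
    exact (H (hxy.trans_lt hε)).le
  obtain ⟨ε, hε, hε0⟩ := (key.and self_mem_nhdsWithin).exists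
  refine ⟨ε, hε0, fun x => measure_mono_null (show _ ⊆ dynamicalBall f δ x from fun y hy i => ?_) (h x)⟩
  have hn' : (0 : ℤ) < n := by exact_mod_cast hn
  obtain ⟨j, hj⟩ := Int.eq_ofNat_of_zero_le (Int.emod_nonneg i hn'.ne')
  have hjn : j < n := by have := Int.emod_lt_of_pos i hn'; omega
  have hi : f ^ i = f ^ j * (f ^ n) ^ (i / n) := by
    rw [← zpow_natCast f n, ← zpow_mul, ← zpow_natCast f j, ← zpow_add, ← hj,
      Int.emod_add_mul_ediv]
  rw [hi]
  exact hε j (Finset.mem_range.2 hjn) _ _ (hy (i / n))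

theorem IsMeasureExpansive.measure_eq_zero_of_periodicPt {f : UnitAddCircle ≃ₜ UnitAddCircle}
    {μ : Measure UnitAddCircle} (he : IsMeasureExpansive f μ) {p : UnitAddCircle}
    (hp : p ∈ Function.periodicPts f) : μ univ = 0 := by
  obtain ⟨n, hn, hp⟩ := hp
  have hp' : (f ^ n) p = p := by rw [Homeomorph.coe_pow_eq_iterate]; exact hp
  obtain ⟨K, hK⟩ := exists_isLift (f ^ n)
  -- Squaring restores orientation if `f ^ n` reverses it.
  have hm : StrictMono ⇑(K * K) := by
    rcases K.continuous.strictMono_of_inj K.injective with h | h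
    · exact h.comp h
    · exact h.comp h
  refine IsMeasureExpansive.measure_eq_zero_of_isLift (g := f ^ n * f ^ n) ?_ (hK.mul hK) hm
    (p := p) ?_
  · rw [← pow_add]; exact he.pow (by omega)
  · change (f ^ n) ((f ^ n) p) = p
    rw [hp', hp']

/-! ### Rotations, orientation reversal and the forward implication -/

theorem IsConjugateToRotation.measure_eq_zero {f : UnitAddCircle ≃ₜ UnitAddCircle}
    {μ : Measure UnitAddCircle} (hf : IsConjugateToRotation f) (he : IsMeasureExpansive f μ) :
    μ univ = 0 := by
  obtain ⟨a, h, hs⟩ := hf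
  obtain ⟨δ, hδ, H⟩ := he
  have hinv (x) : h (f⁻¹ x) = h x - a := by
    have := hs (f⁻¹ x)
    rw [show f (f⁻¹ x) = x from f.apply_symm_apply x] at this
    rw [this, add_sub_cancel_right]
  have hiter (i : ℤ) : ∀ x, h ((f ^ i) x) = h x + i • a := by
    induction i with
    | zero => intro x; simp
    | succ n ih =>
      intro x
      rw [zpow_add_one, add_zsmul, one_zsmul]
      change h ((f ^ (n : ℤ)) (f x)) = _
      rw [ih, hs x, add_assoc, add_comm a]
    | pred n ih =>
      intro x
      rw [zpow_sub_one, sub_zsmul, one_zsmul]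
      change h ((f ^ (-n : ℤ)) (f⁻¹ x)) = _
      rw [ih, hinv x, sub_add_eq_add_sub, add_sub_assoc, sub_eq_add_neg]
  obtain ⟨η, hη, H1⟩ := Metric.uniformContinuous_iff.1
    (CompactSpace.uniformContinuous_of_continuous h.symm.continuous) δ hδ
  obtain ⟨ε, hε, H2⟩ := Metric.uniformContinuous_iff.1
    (CompactSpace.uniformContinuous_of_continuous h.continuous) η hη
  refine measure_null_of_locally_null _ fun x _ => ⟨Metric.ball x ε,
    mem_nhdsWithin_of_mem_nhds (Metric.ball_mem_nhds x hε), measure_mono_null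
    (show _ ⊆ dynamicalBall f δ x from fun y hy i => ?_) (H x)⟩
  have h1 : dist (h ((f ^ i) x)) (h ((f ^ i) y)) < η := by
    rw [hiter, hiter, dist_add_right, dist_comm]
    exact H2 hy
  simpa using (H1 h1).le

theorem exists_mem_periodicPts_of_strictAnti_lift {F : ℝ ≃ₜ ℝ}
    {f : UnitAddCircle ≃ₜ UnitAddCircle} (hF : IsLift F f) (hm : StrictAnti F) :
    ∃ p, p ∈ Function.periodicPts f := by
  have h1 : F 1 = F 0 - 1 := by simpa using hF.map_add_one_of_strictAnti hm 0
  have hc : ContinuousOn (fun t => F t - t) (Icc 0 1) := by fun_prop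
  -- `F t - t` drops by 2 over `[0, 1]`, hence takes an integer value.
  obtain ⟨t, -, ht⟩ := intermediate_value_Icc' zero_le_one hc
    (show (⌊F 0⌋ : ℝ) ∈ Icc (F 1 - 1) (F 0 - 0) from
      ⟨by rw [h1]; linarith [Int.lt_floor_add_one (F 0)], by
        rw [sub_zero]; exact Int.floor_le _⟩)
  refine ⟨t, 1, one_pos, ?_⟩
  change f (t : UnitAddCircle) = t
  rw [← hF]
  exact UnitAddCircle.coe_eq_coe_iff.2 ⟨⌊F 0⌋, by linarith⟩

theorem isDenjoy_of_isMeasureExpansive {f : UnitAddCircle ≃ₜ UnitAddCircle}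
    {μ : Measure UnitAddCircle} [IsProbabilityMeasure μ] (he : IsMeasureExpansive f μ) :
    IsDenjoy f := by
  have hμ : μ univ ≠ 0 := by simp
  have hper (p) : p ∉ Function.periodicPts f := fun hp => hμ (he.measure_eq_zero_of_periodicPt hp)
  refine ⟨?_, fun h => hμ (h.measure_eq_zero he), eq_empty_of_forall_notMem hper⟩
  obtain ⟨F, hF⟩ := exists_isLift f
  rcases F.continuous.strictMono_of_inj F.injective with h | h
  · exact ⟨⟨⟨F, h.monotone⟩, hF.map_add_one_of_strictMono h⟩, F.continuous, hF⟩
  · obtain ⟨p, hp⟩ := exists_mem_periodicPts_of_strictAnti_lift hF h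
    exact absurd hp (hper p)

/-! ### Degree one lifts and closeness of lifted orbits -/

theorem IsLift.bijective_of_circleDeg1Lift {f : UnitAddCircle ≃ₜ UnitAddCircle}
    {F : CircleDeg1Lift} (hc : Continuous F)
    (hF : ∀ t : ℝ, ((F t : ℝ) : UnitAddCircle) = f (t : UnitAddCircle)) :
    Function.Bijective F := by
  refine ⟨fun s t hst => ?_, F.continuous_iff_surjective.1 hc⟩
  obtain ⟨n, rfl⟩ := UnitAddCircle.coe_eq_coe_iff.1
    (f.injective (by rw [← hF, ← hF, hst]) : (s : UnitAddCircle) = t)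
  rw [F.map_add_int] at hst
  linarith

theorem CircleDeg1Lift.exists_homeomorph {F : CircleDeg1Lift} (hF : Function.Bijective F) :
    ∃ H : ℝ ≃ₜ ℝ, StrictMono H ∧ ∀ t, H t = F t :=
  have hm : StrictMono F := F.strictMono_iff_injective.2 hF.1
  ⟨(hm.orderIsoOfSurjective F hF.2).toHomeomorph, hm, fun _ => rfl⟩

theorem irrational_translationNumber {f : UnitAddCircle ≃ₜ UnitAddCircle}
    (hper : Function.periodicPts f = ∅) {F : CircleDeg1Lift} (hc : Continuous F)
    (hF : ∀ t : ℝ, ((F t : ℝ) : UnitAddCircle) = f (t : UnitAddCircle)) :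
    Irrational F.translationNumber := by
  rintro ⟨q, hq⟩
  rw [Rat.cast_def, eq_comm, F.translationNumber_eq_rat_iff hc q.den_pos] at hq
  obtain ⟨x, hx⟩ := hq
  have hiter (n : ℕ) (t : ℝ) : (((F ^ n) t : ℝ) : UnitAddCircle) = f^[n] t := by
    rw [F.coe_pow]
    exact (Function.Semiconj.iterate_right (f := ((↑) : ℝ → UnitAddCircle)) hF n) t
  have : (x : UnitAddCircle) ∈ Function.periodicPts f :=
    ⟨q.den, q.den_pos, (hiter _ _).symm.trans (UnitAddCircle.coe_eq_coe_iff.2 ⟨_, hx⟩)⟩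
  rw [hper] at this
  exact this

/-- A bijective degree one monotone map of the line descends to a circle homeomorphism. -/
theorem CircleDeg1Lift.exists_circle_homeomorph {F : CircleDeg1Lift} (hF : Function.Bijective F) :
    ∃ h : UnitAddCircle ≃ₜ UnitAddCircle, ∀ t : ℝ, h t = (F t : ℝ) := by
  have hper : Function.Periodic (fun t : ℝ => ((F t : ℝ) : UnitAddCircle)) 1 := fun t => by
    simp
  have hl (t : ℝ) : hper.lift (t : UnitAddCircle) = (F t : ℝ) := rfl
  have hcont : Continuous hper.lift := by
    refine (QuotientAddGroup.isQuotientMap_mk _).continuous_iff.2 ?_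
    exact (AddCircle.continuous_mk' 1).comp (F.continuous_iff_surjective.2 hF.2)
  have hbij : Function.Bijective hper.lift := by
    constructor
    · intro x y hxy
      obtain ⟨s, rfl⟩ := QuotientAddGroup.mk_surjective x
      obtain ⟨t, rfl⟩ := QuotientAddGroup.mk_surjective y
      obtain ⟨n, hn⟩ := UnitAddCircle.coe_eq_coe_iff.1 hxy
      rw [← F.map_add_int] at hn
      exact UnitAddCircle.coe_eq_coe_iff.2 ⟨n, hF.1 hn⟩
    · intro y
      obtain ⟨t, rfl⟩ := QuotientAddGroup.mk_surjective y
      obtain ⟨s, hs⟩ := hF.2 t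
      exact ⟨(s : UnitAddCircle), by rw [hl, hs]⟩
  exact ⟨Continuous.homeoOfEquivCompactToT2 (f := Equiv.ofBijective _ hbij) hcont, hl⟩

theorem CircleDeg1Lift.exists_forall_abs_sub_le {F : CircleDeg1Lift} (hc : Continuous F) {ε : ℝ}
    (hε : 0 < ε) : ∃ η > 0, ∀ s t, |s - t| ≤ η → |F s - F t| ≤ ε := by
  obtain ⟨η, hη, H⟩ := Metric.uniformContinuousOn_iff.1
    ((isCompact_Icc (a := (-1 : ℝ)) (b := 2)).uniformContinuousOn_of_continuous hc.continuousOn)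
    ε hε
  -- The bound 1 keeps both points in `[-1, 2]` once `s` is moved into `[0, 1)`.
  refine ⟨min (η / 2) 1, by positivity, fun s t hst => ?_⟩
  have h1 := hst.trans (min_le_left _ _)
  have h2 := abs_le.1 (hst.trans (min_le_right _ _))
  have h3 := Int.floor_le s
  have h4 := Int.lt_floor_add_one s
  have := H (s - ⌊s⌋) ⟨by linarith, by linarith⟩ (t - ⌊s⌋)
    ⟨by linarith [h2.2], by linarith [h2.1]⟩
    (by rw [Real.dist_eq, sub_sub_sub_cancel_right]; linarith)
  rw [F.map_sub_int, F.map_sub_int, Real.dist_eq, sub_sub_sub_cancel_right] at this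
  exact this.le

theorem IsLift.exists_forall_abs_sub_le {G : ℝ ≃ₜ ℝ} {g : UnitAddCircle ≃ₜ UnitAddCircle}
    (hG : IsLift G g) (hm : StrictMono G) {ε : ℝ} (hε : 0 < ε) :
    ∃ η > 0, ∀ s t, |s - t| ≤ η → |G s - G t| ≤ ε :=
  CircleDeg1Lift.exists_forall_abs_sub_le
    (F := ⟨⟨G, hm.monotone⟩, hG.map_add_one_of_strictMono hm⟩) G.continuous hε

/-- For small `δ`, points of the line that are `δ`-close and whose projections have `δ`-close
orbits on the circle have `δ`-close orbits on the line. -/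
theorem IsLift.exists_forall_abs_zpow_sub_le {G : ℝ ≃ₜ ℝ} {g : UnitAddCircle ≃ₜ UnitAddCircle}
    (hG : IsLift G g) (hm : StrictMono G) :
    ∃ η > 0, ∀ δ ≤ η, ∀ s t : ℝ, |s - t| ≤ δ → (t : UnitAddCircle) ∈ dynamicalBall g δ s →
      ∀ i : ℤ, |(G ^ i) s - (G ^ i) t| ≤ δ := by
  obtain ⟨η₁, hη₁, h₁⟩ := hG.exists_forall_abs_sub_le hm (ε := 1 / 2) (by norm_num)
  obtain ⟨η₂, hη₂, h₂⟩ := hG.inv.exists_forall_abs_sub_le hm.homeomorph_inv (ε := 1 / 2)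
    (by norm_num)
  refine ⟨min η₁ η₂, lt_min hη₁ hη₂, fun δ hδ s t hst ht i => ?_⟩
  -- Up to distance 1/2 the line and circle distances agree, so the crude bound from uniform
  -- continuity improves to `δ` at each step.
  have key (i : ℤ) (hi : |(G ^ i) s - (G ^ i) t| ≤ 1 / 2) : |(G ^ i) s - (G ^ i) t| ≤ δ := by
    rw [← UnitAddCircle.dist_coe_eq hi, hG.zpow i, hG.zpow i]
    exact ht i
  induction i with
  | zero => exact hst
  | succ n ih =>
    refine key _ ?_
    rw [add_comm, zpow_one_add]
    exact h₁ _ _ (ih.trans (hδ.trans (min_le_left _ _)))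
  | pred n ih =>
    refine key _ ?_
    rw [show (-n - 1 : ℤ) = -1 + -n by ring, zpow_add, zpow_neg_one]
    exact h₂ _ _ (ih.trans (hδ.trans (min_le_right _ _)))

theorem exists_int_mul_add_int_mem_Ioo {τ : ℝ} (hτ : Irrational τ) {c d : ℝ} (h : c < d) :
    ∃ i m : ℤ, i * τ + m ∈ Ioo c d := by
  have hd : Dense (AddSubgroup.closure {τ, 1} : Set ℝ) :=
    dense_addSubgroupClosure_pair_iff.2 (by rwa [div_one])
  obtain ⟨z, hz, hmem⟩ := hd.exists_mem_open isOpen_Ioo (nonempty_Ioo.2 h)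
  obtain ⟨i, m, rfl⟩ := AddSubgroup.mem_closure_pair.1 hz
  exact ⟨i, m, by simpa using hmem⟩

/-! ### Semiconjugacy to an irrational translation -/

/-- Data of a semiconjugacy from a circle homeomorphism to an irrational rotation. -/
structure IsRotationSemiconj (h : CircleDeg1Lift) (G : ℝ ≃ₜ ℝ) (τ : ℝ) : Prop where
  irrational : Irrational τ
  map_eq : ∀ t, h (G t) = h t + τ

namespace IsRotationSemiconj

variable {h : CircleDeg1Lift} {G : ℝ ≃ₜ ℝ} {τ : ℝ}

theorem map_zpow (hs : IsRotationSemiconj h G τ) (i : ℤ) (t : ℝ) :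
    h ((G ^ i) t) = h t + i * τ := by
  induction i generalizing t with
  | zero => simp
  | succ n ih =>
    rw [zpow_add_one]
    change h ((G ^ (n : ℤ)) (G t)) = _
    rw [ih, hs.map_eq]; push_cast; ring
  | pred n ih =>
    rw [zpow_sub_one]
    change h ((G ^ (-n : ℤ)) (G⁻¹ t)) = _
    have := hs.map_eq (G⁻¹ t)
    rw [show G (G⁻¹ t) = t from G.apply_symm_apply t] at this
    rw [ih, this]; push_cast; ring

/-- The range contains the dense set of all `h 0 + i * τ + m`, and a monotone map with dense range
has no jumps. -/
theorem continuous (hs : IsRotationSemiconj h G τ) : Continuous h := by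
  refine Monotone.continuous_of_denseRange h.monotone (dense_iff_inter_open.2 fun U hU hne => ?_)
  obtain ⟨x, hx⟩ := hne
  obtain ⟨ε, hε, hb⟩ := Metric.isOpen_iff.1 hU x hx
  obtain ⟨i, m, h1, h2⟩ := exists_int_mul_add_int_mem_Ioo hs.irrational
    (show x - h 0 - ε < x - h 0 + ε by linarith)
  refine ⟨h ((G ^ i) 0 + m), hb ?_, mem_range_self _⟩
  rw [h.map_add_int, hs.map_zpow, Metric.mem_ball, Real.dist_eq, abs_lt]
  constructor <;> linarith

/-- By density some `h a - m` lies strictly between `h x + i * τ` and `h y + i * τ`; then `[a - m, b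
- m]` separates the iterates. -/
theorem exists_le_zpow_sub (hs : IsRotationSemiconj h G τ) {a b x y : ℝ} (hab : h a = h b)
    (hxy : h x < h y) : ∃ i : ℤ, b - a < (G ^ i) y - (G ^ i) x := by
  obtain ⟨i, m, h1, h2⟩ := exists_int_mul_add_int_mem_Ioo hs.irrational
    (sub_lt_sub_left hxy (h a))
  refine ⟨i, ?_⟩
  have e1 : (G ^ i) x < a - m := h.monotone.reflect_lt <| by
    rw [hs.map_zpow, h.map_sub_int]; linarith
  have e2 : b - m < (G ^ i) y := h.monotone.reflect_lt <| by
    rw [hs.map_zpow, h.map_sub_int, ← hab]; linarith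
  linarith

end IsRotationSemiconj

/-! ### The measure `dh` and its null fibres -/

/-- The measure on the circle induced by a monotone degree one map of the line. -/
noncomputable def CircleDeg1Lift.circleMeasure (h : CircleDeg1Lift) (hc : Continuous h) :
    Measure UnitAddCircle :=
  Measure.map ((↑) : ℝ → UnitAddCircle)
    ((StieltjesFunction.mk h h.monotone fun _ => hc.continuousWithinAt).measure.restrict (Ioc 0 1))

theorem UnitAddCircle.measurable_coe : Measurable ((↑) : ℝ → UnitAddCircle) :=
  (AddCircle.continuous_mk' (1 : ℝ)).measurable

namespace CircleDeg1Lift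

variable {h : CircleDeg1Lift} (hc : Continuous h)

theorem isProbabilityMeasure_circleMeasure : IsProbabilityMeasure (h.circleMeasure hc) := by
  constructor
  rw [circleMeasure, Measure.map_apply UnitAddCircle.measurable_coe MeasurableSet.univ,
    preimage_univ, Measure.restrict_apply_univ, StieltjesFunction.measure_Ioc]
  change ENNReal.ofReal (h 1 - h 0) = 1
  have : h 1 = h 0 + 1 := by simpa using h.map_add_one 0
  rw [this]; simp

theorem isCompact_level (hc : Continuous h) (c : ℝ) : IsCompact {t | h t = c} := by
  rcases Set.eq_empty_or_nonempty {t | h t = c} with he | ⟨t, ht⟩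
  · rw [he]; exact isCompact_empty
  refine Metric.isCompact_of_isClosed_isBounded (isClosed_eq hc continuous_const) ?_
  refine (Metric.isBounded_Icc (t - 1) (t + 1)).subset fun s hs => ?_
  have h1 : h (t + 1) = c + 1 := by rw [h.map_add_one, ht]
  have h2 : h (t - 1) = c - 1 := by
    have := h.map_sub_int t 1
    rw [ht] at this
    simpa using this
  have hs' : h s = c := hs
  exact ⟨(h.monotone.reflect_lt (by linarith)).le, (h.monotone.reflect_lt (by linarith)).le⟩

theorem stieltjes_measure_level_eq_zero (c : ℝ) :
    (StieltjesFunction.mk h h.monotone fun _ => hc.continuousWithinAt).measure {t | h t = c}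
      = 0 := by
  rcases Set.eq_empty_or_nonempty {t | h t = c} with he | hne
  · rw [he, measure_empty]
  have hcpt := isCompact_level hc c
  obtain ⟨a, ha, hamin⟩ := hcpt.exists_isLeast hne
  obtain ⟨b, hb, hbmax⟩ := hcpt.exists_isGreatest hne
  refine measure_mono_null (t := Icc a b) (fun t ht => ⟨hamin ht, hbmax ht⟩) ?_
  rw [StieltjesFunction.measure_Icc]
  change ENNReal.ofReal (h b - Function.leftLim h a) = 0
  rw [(hc.continuousAt.continuousWithinAt).leftLim_eq, show h a = c from ha, show h b = c from hb]
  simp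

theorem circleMeasure_eq_zero {s : Set UnitAddCircle} {c : ℝ}
    (hs : s ⊆ (↑) '' {t : ℝ | h t = c}) : h.circleMeasure hc s = 0 := by
  have hms : MeasurableSet ((↑) '' {t : ℝ | h t = c} : Set UnitAddCircle) :=
    ((isCompact_level hc c).image (AddCircle.continuous_mk' (1 : ℝ))).measurableSet
  refine measure_mono_null hs ?_
  rw [circleMeasure, Measure.map_apply UnitAddCircle.measurable_coe hms]
  refine le_antisymm ((Measure.restrict_apply_le _ _).trans ?_) zero_le
  -- The full preimage of a projected level consists of its integer translates.
  refine (measure_mono_null (t := ⋃ n : ℤ, {t | h t = c + n}) ?_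
    (measure_iUnion_null fun n => stieltjes_measure_level_eq_zero hc _)).le
  rintro t ⟨u, hu, hut⟩
  obtain ⟨n, rfl⟩ := UnitAddCircle.coe_eq_coe_iff.1 hut.symm
  exact mem_iUnion.2 ⟨n, by rw [mem_ofPred_eq, h.map_add_int, hu]⟩

end CircleDeg1Lift

/-! ### The converse implication and the equivalence -/

theorem IsDenjoy.exists_isMeasureExpansive {f : UnitAddCircle ≃ₜ UnitAddCircle} (hf : IsDenjoy f) :
    ∃ μ : Measure UnitAddCircle, IsProbabilityMeasure μ ∧ IsMeasureExpansive f μ := by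
  obtain ⟨F, hFc, hF⟩ := hf.orientationPreserving
  have hbij := IsLift.bijective_of_circleDeg1Lift hFc hF
  have hirr := irrational_translationNumber hf.no_periodic hFc hF
  obtain ⟨G, hGm, hGF⟩ := CircleDeg1Lift.exists_homeomorph hbij
  have hG : IsLift G f := fun t => by rw [hGF, hF]
  set τ := F.translationNumber
  obtain ⟨h, hh⟩ := CircleDeg1Lift.semiconj_of_isUnit_of_translationNumber_eq
    (f₂ := CircleDeg1Lift.translate (Multiplicative.ofAdd τ))
    (CircleDeg1Lift.isUnit_iff_bijective.2 hbij) (Units.isUnit _)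
    (CircleDeg1Lift.translationNumber_translate τ).symm
  have hs : IsRotationSemiconj h G τ := ⟨hirr, fun t => by
    rw [hGF, hh t, CircleDeg1Lift.translate_apply, add_comm]⟩
  have hc := hs.continuous
  -- An injective `h` would descend to a conjugacy with a rotation.
  obtain ⟨a, b, hab, hlt⟩ : ∃ a b, h a = h b ∧ a < b := by
    by_contra! H
    have hinj : Function.Injective h := fun s t hst => le_antisymm (H t s hst.symm) (H s t hst)
    obtain ⟨k, hk⟩ := CircleDeg1Lift.exists_circle_homeomorph
      ⟨hinj, h.continuous_iff_surjective.1 hc⟩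
    refine hf.not_conjugate ⟨(τ : ℝ), k, fun x => ?_⟩
    obtain ⟨t, rfl⟩ := QuotientAddGroup.mk_surjective x
    change k (f (t : UnitAddCircle)) = k (t : UnitAddCircle) + (τ : UnitAddCircle)
    rw [← hG, hk, hk, hs.map_eq, AddCircle.coe_add]
  obtain ⟨η, hη, H⟩ := hG.exists_forall_abs_zpow_sub_le hGm
  refine ⟨h.circleMeasure hc, CircleDeg1Lift.isProbabilityMeasure_circleMeasure hc,
    min η (b - a), lt_min hη (sub_pos.2 hlt), fun x => ?_⟩
  obtain ⟨s, rfl⟩ := QuotientAddGroup.mk_surjective x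
  refine CircleDeg1Lift.circleMeasure_eq_zero hc (c := h s) fun y hy => ?_
  -- The representative nearest to `s` starts within the allowed distance on the line.
  obtain ⟨t, rfl, hst⟩ := UnitAddCircle.exists_coe_eq_abs_sub_eq_dist s y
  refine ⟨t, ?_, rfl⟩
  have hclose := H _ (min_le_left _ _) s t (hst.le.trans (hy 0)) hy
  rcases lt_trichotomy (h s) (h t) with hlt' | heq | hlt'
  · obtain ⟨i, hi⟩ := hs.exists_le_zpow_sub hab hlt'
    have := (abs_le.1 ((hclose i).trans (min_le_right _ _))).1
    linarith
  · exact heq.symm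
  · obtain ⟨i, hi⟩ := hs.exists_le_zpow_sub hab hlt'
    have := (abs_le.1 ((hclose i).trans (min_le_right _ _))).2
    linarith

theorem mainTheorem2 (f : UnitAddCircle ≃ₜ UnitAddCircle) :
    (∃ μ : Measure UnitAddCircle, IsProbabilityMeasure μ ∧ IsMeasureExpansive f μ) ↔
      IsDenjoy f :=
  ⟨fun ⟨_, _, he⟩ => isDenjoy_of_isMeasureExpansive he, fun hf => hf.exists_isMeasureExpansive⟩
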